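/- Let $n\ge 0$ be an integer and let $K$ be a closed connected subgroup of $GL(n,\mathbb{R})$. Put $$H=\left\{\begin{bmatrix} h & 0\\ 0& \mathrm{Id}_n\end{bmatrix} : h\in K\right\},\qquad N=\left\{\begin{bmatrix} \mathrm{Id}_n & x\\ 0& \mathrm{Id}_n\end{bmatrix} : x\in\mathfrak{gl}(n,\mathbb{R})\right\},\qquad G=NH\subset GL(2n,\mathbb{R}),$$ so that $G$ is a group in which $N$ is normal. Let $\mathfrak{n}$ be the Lie algebra of $N$ (the space of velocities at the identity of smooth curves in $N$), let $\mathfrak{n}^*$ be its dual, and for $s\in G$ let $\mathrm{Ad}(s)X=sXs^{-1}$ on $\mathfrak{n}$. For an $n\times n$ matrix $\omega$ let $\lambda_\omega\in\mathfrak{n}^*$ be the functional $$\langle \lambda_\omega, X\rangle=\mathrm{Tr}\left(\begin{bmatrix} 0&\omega\\0&0\end{bmatrix}^{T}X\right),\qquad X\in\mathfrak n .$$ For $\lambda\in\mathfrak{n}^*$ define $\beta_\lambda:H\to\mathfrak{n}^*$ by $\beta_\lambda(h)=\mathrm{Ad}(h^{-1})^*\lambda$, that is, $\langle\beta_\lambda(h),X\rangle=\langle\lambda,\mathrm{Ad}(h^{-1})X\rangle$.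 Then there is $\lambda\in\mathfrak{n}^*$, namely $\lambda=\lambda_{\mathrm{Id}_n}$, such that $$\beta_\lambda\left(\begin{bmatrix} h & 0\\ 0& \mathrm{Id}_n\end{bmatrix}\right)=\lambda_{(h^{-1})^T}\qquad\text{for all } h\in K,$$ and $\beta_\lambda$ is smooth and is an immersion at the identity of $H$: its differential at the identity, the linear map on the Lie algebra of $H$ that sends $\gamma'(0)$ to $(\beta_\lambda\circ\gamma)'(0)$ for every smooth curve $\gamma$ in $H$ with $\gamma(0)=\mathrm{Id}$, is injective. The same holds for every smooth manifold structure on $H$, compatible with its subspace topology, for which the inclusion of $H$ into the space of $2n\times 2n$ matrices is an immersion: with respect to this structure $\beta_\lambda$ is smooth and its differential at the identity is injective. -/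

import Mathlib

open Matrix Filter Topology
open scoped Manifold ContDiff Pointwise

namespace MatrixLie

/-- The space of `m × m` real matrices, normed by the maximum of the absolute values of the entries.
The topology that the norm induces is the usual one, and is made to agree syntactically with
Mathlib's topology on matrices. -/
@[reducible]
def matrixNormed (m : Type) [Fintype m] : NormedAddCommGroup (Matrix m m ℝ) :=
  { (inferInstance : AddCommGroup (Matrix m m ℝ)) with
    norm := (Matrix.normedAddCommGroup : NormedAddCommGroup (Matrix m m ℝ)).norm
    toMetricSpace := MetricSpace.replaceUniformity (U := Matrix.instUniformSpace m m ℝ)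
      (Matrix.normedAddCommGroup : NormedAddCommGroup (Matrix m m ℝ)).toMetricSpace rfl
    dist_eq := (Matrix.normedAddCommGroup : NormedAddCommGroup (Matrix m m ℝ)).dist_eq }

attribute [local instance] matrixNormed

/-- The normed space structure that belongs to `matrixNormed`. -/
@[reducible]
def matrixNormedSpace (m : Type) [Fintype m] : NormedSpace ℝ (Matrix m m ℝ) :=
  { (inferInstance : Module ℝ (Matrix m m ℝ)) with
    norm_smul_le := (Matrix.normedSpace :
      @NormedSpace ℝ (Matrix m m ℝ) _
        (Matrix.normedAddCommGroup).toSeminormedAddCommGroup).norm_smul_le }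

end MatrixLie

attribute [local instance] MatrixLie.matrixNormed MatrixLie.matrixNormedSpace

noncomputable section

namespace MatrixLie

section General

variable {m : Type} [Fintype m] [DecidableEq m]

/-- The underlying matrix of an element of a matrix group `S ≤ GL(m, ℝ)`, i.e. the inclusion of `S`
into the vector space of `m × m` matrices. -/
def incl (S : Subgroup (GL m ℝ)) (g : S) : Matrix m m ℝ := ((g : GL m ℝ) : Matrix m m ℝ)

/-- A smooth curve of matrices that stays in the matrix group `S` and passes through the identity
at time `0`. -/
structure IsCurve (S : Subgroup (GL m ℝ)) (γ : ℝ → S) : Prop where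
  smooth : ContDiff ℝ ∞ (fun t => incl S (γ t))
  map_zero : γ 0 = 1

/-- The Lie algebra of a matrix group `S ≤ GL(m, ℝ)`, as a space of matrices: its tangent space at
the identity, consisting of the velocities at the identity of the smooth curves in `S`. -/
def lieAlg (S : Subgroup (GL m ℝ)) : Submodule ℝ (Matrix m m ℝ) where
  carrier := {X | ∃ γ : ℝ → S, IsCurve S γ ∧ HasDerivAt (fun t => incl S (γ t)) X 0}
  zero_mem' := ⟨fun _ => 1, ⟨contDiff_const, rfl⟩, hasDerivAt_const _ _⟩
  add_mem' := by
    rintro X Y ⟨γ, hγ, hX⟩ ⟨δ, hδ, hY⟩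
    have hcoord : ∀ (c : ℝ → Matrix m m ℝ), ContDiff ℝ ∞ c ↔ ∀ i j, ContDiff ℝ ∞ fun t => c t i j :=
      fun c => contDiff_pi.trans (forall_congr' fun i => contDiff_pi)
    have hder : ∀ (c : ℝ → Matrix m m ℝ) (Z : Matrix m m ℝ),
        HasDerivAt c Z 0 ↔ ∀ i j, HasDerivAt (fun t => c t i j) (Z i j) 0 :=
      fun c Z => hasDerivAt_pi.trans (forall_congr' fun i => hasDerivAt_pi)
    have hγ0 : incl S (γ 0) = 1 := by rw [hγ.map_zero]; rfl
    have hδ0 : incl S (δ 0) = 1 := by rw [hδ.map_zero]; rfl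
    have hmul : ∀ t, incl S (γ t * δ t) = incl S (γ t) * incl S (δ t) := fun t => rfl
    refine ⟨fun t => γ t * δ t, ⟨?_, by simp [hγ.map_zero, hδ.map_zero]⟩, ?_⟩
    · have h1 := (hcoord _).1 hγ.smooth
      have h2 := (hcoord _).1 hδ.smooth
      refine (hcoord _).2 fun i j => ?_
      simp only [hmul, Matrix.mul_apply]
      exact ContDiff.sum fun k _ => (h1 i k).mul (h2 k j)
    · have h1 := (hder _ _).1 hX
      have h2 := (hder _ _).1 hY
      refine (hder _ _).2 fun i j => ?_
      simp only [hmul, Matrix.mul_apply]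
      have h := HasDerivAt.fun_sum (u := Finset.univ) fun k _ => (h1 i k).mul (h2 k j)
      refine h.congr_deriv ?_
      simp only [hγ0, hδ0, Finset.sum_add_distrib, ← Matrix.mul_apply]
      simp
  smul_mem' := by
    rintro c X ⟨γ, hγ, hX⟩
    refine ⟨fun t => γ (c * t), ⟨hγ.smooth.comp (contDiff_const.mul contDiff_id), by
      simp [hγ.map_zero]⟩, ?_⟩
    have h1 : HasDerivAt (fun t : ℝ => c * t) c 0 := by
      simpa using (hasDerivAt_id (0 : ℝ)).const_mul c
    have h2 : HasDerivAt (fun t => incl S (γ t)) X (c * 0) := by simpa using hX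
    exact h2.scomp (0 : ℝ) h1

/-- If `s` normalizes `S`, conjugation by `s` maps the Lie algebra of `S` into itself. -/
theorem conj_mem_lieAlg (S : Subgroup (GL m ℝ)) (s : GL m ℝ)
    (hs : s ∈ Subgroup.normalizer (S : Set (GL m ℝ)))
    {X : Matrix m m ℝ} (hX : X ∈ lieAlg S) :
    (s : Matrix m m ℝ) * X * ((s⁻¹ : GL m ℝ) : Matrix m m ℝ) ∈ lieAlg S := by
  obtain ⟨γ, hγ, hX⟩ := hX
  let L : Matrix m m ℝ →L[ℝ] Matrix m m ℝ := LinearMap.toContinuousLinearMap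
    (LinearMap.mulLeft ℝ (s : Matrix m m ℝ) ∘ₗ
      LinearMap.mulRight ℝ ((s⁻¹ : GL m ℝ) : Matrix m m ℝ))
  have hL : ∀ Y, L Y = (s : Matrix m m ℝ) * Y * ((s⁻¹ : GL m ℝ) : Matrix m m ℝ) := fun Y => by
    simp [L, mul_assoc]
  have hmem : ∀ t, s * (γ t : GL m ℝ) * s⁻¹ ∈ S := fun t =>
    (Subgroup.mem_normalizer_iff.1 hs _).1 (γ t).2
  have hincl : (fun t => incl S ⟨_, hmem t⟩) = fun t => L (incl S (γ t)) := by
    funext t; rw [hL]; simp [incl]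
  refine ⟨fun t => ⟨_, hmem t⟩, ⟨?_, ?_⟩, ?_⟩
  · rw [hincl]; exact L.contDiff.comp hγ.smooth
  · ext1; simp [hγ.map_zero]
  · rw [hincl, ← hL]
    exact L.hasFDerivAt.comp_hasDerivAt (0 : ℝ) hX

/-- `Ad(s)` on the Lie algebra of `S`, for `s` normalizing `S`: the differential at the identity of
the conjugation `y ↦ s y s⁻¹`, which for matrix groups is `X ↦ s X s⁻¹`. -/
def Ad (S : Subgroup (GL m ℝ)) (s : Subgroup.normalizer (S : Set (GL m ℝ))) :
    lieAlg S →L[ℝ] lieAlg S :=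
  LinearMap.toContinuousLinearMap
    (LinearMap.restrict
      (LinearMap.mulRight ℝ (((s : GL m ℝ)⁻¹ : GL m ℝ) : Matrix m m ℝ) ∘ₗ
        LinearMap.mulLeft ℝ ((s : GL m ℝ) : Matrix m m ℝ))
      fun _ hX => conj_mem_lieAlg S s s.2 hX)

/-- `Ad(s)` is indeed the differential at the identity of the conjugation by `s`: it maps the
velocity of a curve `γ` to the velocity of `t ↦ s γ(t) s⁻¹`. -/
theorem hasDerivAt_conj (S : Subgroup (GL m ℝ)) (s : Subgroup.normalizer (S : Set (GL m ℝ)))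
    (γ : ℝ → S) (X : lieAlg S)
    (hX : HasDerivAt (fun t => incl S (γ t)) (X : Matrix m m ℝ) 0) :
    HasDerivAt (fun t => ((s : GL m ℝ) : Matrix m m ℝ) * incl S (γ t) *
      (((s : GL m ℝ)⁻¹ : GL m ℝ) : Matrix m m ℝ)) (Ad S s X : Matrix m m ℝ) 0 :=
  (LinearMap.toContinuousLinearMap
    (LinearMap.mulRight ℝ (((s : GL m ℝ)⁻¹ : GL m ℝ) : Matrix m m ℝ) ∘ₗ
      LinearMap.mulLeft ℝ ((s : GL m ℝ) : Matrix m m ℝ))).hasFDerivAt.comp_hasDerivAt (0 : ℝ) hX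

/-- The coadjoint operator `Ad(s)^*` on the dual of the Lie algebra of `S`:
`⟨Ad(s)^* μ, X⟩ = ⟨μ, Ad(s) X⟩`. -/
def AdStar (S : Subgroup (GL m ℝ)) (s : Subgroup.normalizer (S : Set (GL m ℝ)))
    (μ : StrongDual ℝ (lieAlg S)) : StrongDual ℝ (lieAlg S) :=
  μ.comp (Ad S s)

/-- The linear functional `X ↦ Tr(Wᵀ X)` on the Lie algebra of `S` given by the matrix `W`. -/
def traceFunctional (S : Subgroup (GL m ℝ)) (W : Matrix m m ℝ) : StrongDual ℝ (lieAlg S) :=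
  LinearMap.toContinuousLinearMap
    (Matrix.traceLinearMap m ℝ ℝ ∘ₗ LinearMap.mulLeft ℝ Wᵀ ∘ₗ (lieAlg S).subtype)

/-- A map `f` on a matrix group `S` is smooth if near each point of `S` it is the restriction of
a smooth map defined on a neighbourhood of the point in the space of matrices. -/
def IsSmooth {F : Type} [NormedAddCommGroup F] [NormedSpace ℝ F]
    (S : Subgroup (GL m ℝ)) (f : S → F) : Prop :=
  ∀ p : S, ∃ f' : Matrix m m ℝ → F, ContDiffAt ℝ ∞ f' (incl S p) ∧
    ∀ᶠ q in 𝓝 p, f q = f' (incl S q)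

/-- A smooth map `f` on a matrix group `S` is an immersion at the identity if its differential
there, i.e. the linear map `D` on the Lie algebra of `S` that sends the velocity at `t = 0` of each
smooth curve `γ` of `S` through the identity to that of `f ∘ γ`, is injective. -/
def IsImmersionAtOne {F : Type} [NormedAddCommGroup F] [NormedSpace ℝ F]
    (S : Subgroup (GL m ℝ)) (f : S → F) : Prop :=
  IsSmooth S f ∧
    ∃ D : lieAlg S →ₗ[ℝ] F, Function.Injective D ∧
      ∀ (γ : ℝ → S), IsCurve S γ → ∀ A : lieAlg S,
        HasDerivAt (fun t => incl S (γ t)) (A : Matrix m m ℝ) 0 →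
        HasDerivAt (fun t => f (γ t)) (D A) 0

end General

section Blocks

variable {n : ℕ}

/-- The homomorphism `h ↦ diag(h, Id)` from `GL(n, ℝ)` to `GL(2n, ℝ)`. -/
def diagHom (n : ℕ) : GL (Fin n) ℝ →* GL (Fin n ⊕ Fin n) ℝ :=
  Units.map
    { toFun := fun A : Matrix (Fin n) (Fin n) ℝ => Matrix.fromBlocks A 0 0 1
      map_one' := Matrix.fromBlocks_one
      map_mul' := fun A B => by simp [Matrix.fromBlocks_multiply] }

/-- The group `H` of the matrices `diag(h, Id)` with `h ∈ K`. -/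
def groupH (K : Subgroup (GL (Fin n) ℝ)) : Subgroup (GL (Fin n ⊕ Fin n) ℝ) :=
  K.map (diagHom n)

/-- The group `N` of the block matrices `[[Id, x], [0, Id]]` with `x` any `n × n` matrix. -/
def groupN (n : ℕ) : Subgroup (GL (Fin n ⊕ Fin n) ℝ) where
  carrier := {g | ∃ x : Matrix (Fin n) (Fin n) ℝ,
    (g : Matrix (Fin n ⊕ Fin n) (Fin n ⊕ Fin n) ℝ) = Matrix.fromBlocks 1 x 0 1}
  one_mem' := ⟨0, by simp⟩
  mul_mem' := by
    rintro a b ⟨x, hx⟩ ⟨y, hy⟩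
    exact ⟨y + x, by simp [hx, hy, Matrix.fromBlocks_multiply]⟩
  inv_mem' := by
    rintro a ⟨x, hx⟩
    refine ⟨-x, ?_⟩
    have h : (a : Matrix (Fin n ⊕ Fin n) (Fin n ⊕ Fin n) ℝ) * Matrix.fromBlocks 1 (-x) 0 1 = 1 := by
      simp [hx, Matrix.fromBlocks_multiply]
    exact Units.inv_eq_of_mul_eq_one_right h

theorem groupH_le_normalizer (K : Subgroup (GL (Fin n) ℝ)) :
    groupH K ≤ Subgroup.normalizer (groupN n : Set (GL (Fin n ⊕ Fin n) ℝ)) := by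
  rw [Subgroup.le_normalizer_iff]
  rintro _ ⟨h, -, rfl⟩ g ⟨x, hx⟩
  refine ⟨(h : Matrix (Fin n) (Fin n) ℝ) * x, ?_⟩
  rw [← map_inv]
  simp [diagHom, hx, Matrix.fromBlocks_multiply, -map_inv, -Matrix.coe_units_inv]

/-- The group `G = N H`, with product of sets as underlying set. -/
def groupG (K : Subgroup (GL (Fin n) ℝ)) : Subgroup (GL (Fin n ⊕ Fin n) ℝ) :=
  (groupN n ⊔ groupH K).copy
    ((groupN n : Set (GL (Fin n ⊕ Fin n) ℝ)) * (groupH K : Set (GL (Fin n ⊕ Fin n) ℝ)))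
    (Subgroup.coe_mul_of_right_le_normalizer_left _ _ (groupH_le_normalizer K)).symm

theorem groupH_le_groupG (K : Subgroup (GL (Fin n) ℝ)) : groupH K ≤ groupG K :=
  fun h hh => Set.mem_mul.2 ⟨1, one_mem _, h, hh, one_mul h⟩

/-- `N` is normal in `G`. -/
theorem groupG_le_normalizer (K : Subgroup (GL (Fin n) ℝ)) :
    groupG K ≤ Subgroup.normalizer (groupN n : Set (GL (Fin n ⊕ Fin n) ℝ)) := by
  rintro _ ⟨a, ha, b, hb, rfl⟩
  exact mul_mem (Subgroup.le_normalizer ha) (groupH_le_normalizer K hb)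

/-- The action `s ↦ Ad(s)^*` of `G` on `𝔫^*`, where `𝔫` is the Lie algebra of the normal
subgroup `N` of `G`. -/
def coAd (K : Subgroup (GL (Fin n) ℝ)) (s : groupG K) (μ : StrongDual ℝ (lieAlg (groupN n))) :
    StrongDual ℝ (lieAlg (groupN n)) :=
  AdStar (groupN n) ⟨s, groupG_le_normalizer K s.2⟩ μ

/-- The map `β_μ : H → 𝔫^*`, `β_μ(h) = Ad(h⁻¹)^* μ`. -/
def beta (K : Subgroup (GL (Fin n) ℝ)) (μ : StrongDual ℝ (lieAlg (groupN n))) (h : groupH K) :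
    StrongDual ℝ (lieAlg (groupN n)) :=
  coAd K ⟨h, groupH_le_groupG K h.2⟩⁻¹ μ

/-- The functional on `𝔫` given by an `n × n` matrix `w`: it is the trace pairing with the block
matrix `[[0, w], [0, 0]]`. -/
def functional (w : Matrix (Fin n) (Fin n) ℝ) : StrongDual ℝ (lieAlg (groupN n)) :=
  traceFunctional (groupN n) (Matrix.fromBlocks 0 w 0 0)

/-- The element `diag(h, Id)` of `H`, for `h ∈ K`. -/
def toH (K : Subgroup (GL (Fin n) ℝ)) (h : K) : groupH K :=
  ⟨diagHom n h, Subgroup.mem_map_of_mem _ h.2⟩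

end Blocks

end MatrixLie

end

namespace MatrixLie

/-! ### Smoothness of matrix inversion -/

section Inverse

variable {m : Type} [Fintype m]

/-! Conjugation by `diag(h⁻¹, Id)` turns the upper right block `x` of an element of `𝔫` into `h⁻¹
x`, so `β` at `diag(h, Id)` is `x ↦ Tr(h⁻¹ x)`, the functional of `(h⁻¹)ᵀ` (`beta_toH`). The trace
pairing is nondegenerate, hence this functional determines `h⁻¹`, and inverting gives back `h`.

Thus `β = f ∘ incl` with `f` smooth at every invertible matrix (`beta_eq_blockFunctional`), and `g ∘
β = incl` with `g` differentiable at `β(1)` (`fromBlocks_matrixOfFunctional_beta`). By the chain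
rule `dg ∘ dβ` is the differential of the inclusion, which is injective, so `dβ` is injective. The
argument serves both for velocities of curves and for manifold structures, and needs no description
of the Lie algebra of `H`. -/

theorem contDiff_matrix_iff {E : Type*} [NormedAddCommGroup E] [NormedSpace ℝ E]
    {c : E → Matrix m m ℝ} : ContDiff ℝ ∞ c ↔ ∀ i j, ContDiff ℝ ∞ fun x => c x i j :=
  contDiff_pi.trans (forall_congr' fun _ => contDiff_pi)

theorem contDiffAt_matrix_iff {E : Type*} [NormedAddCommGroup E] [NormedSpace ℝ E]
    {c : E → Matrix m m ℝ} {x : E} :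
    ContDiffAt ℝ ∞ c x ↔ ∀ i j, ContDiffAt ℝ ∞ (fun x => c x i j) x :=
  contDiffAt_pi.trans (forall_congr' fun _ => contDiffAt_pi)

theorem contDiff_matrix_entry (i j : m) : ContDiff ℝ ∞ fun A : Matrix m m ℝ => A i j :=
  contDiff_matrix_iff.1 contDiff_id i j

variable [DecidableEq m]

theorem contDiff_matrix_det {E : Type*} [NormedAddCommGroup E] [NormedSpace ℝ E]
    {c : E → Matrix m m ℝ} (hc : ∀ i j, ContDiff ℝ ∞ fun x => c x i j) :
    ContDiff ℝ ∞ fun x => (c x).det := by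
  simp only [Matrix.det_apply']
  exact ContDiff.sum fun σ _ => contDiff_const.mul (contDiff_prod fun i _ => hc _ _)

/-- Inversion of matrices is smooth at every invertible matrix. -/
theorem contDiffAt_matrix_inv {A : Matrix m m ℝ} (hA : A.det ≠ 0) :
    ContDiffAt ℝ ∞ (fun M : Matrix m m ℝ => M⁻¹) A := by
  refine contDiffAt_matrix_iff.2 fun i j => ?_
  -- Cramer's rule: each entry of the inverse is a polynomial in the entries divided by the
  -- determinant.
  have h : ∀ M : Matrix m m ℝ,
      M⁻¹ i j = M.det⁻¹ * (M.updateRow j (Pi.single i 1)).det := fun M => by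
    rw [Matrix.inv_def, Matrix.smul_apply, Matrix.adjugate_apply, Ring.inverse_eq_inv',
      smul_eq_mul]
  simp only [h]
  refine ContDiffAt.mul ((contDiff_matrix_det contDiff_matrix_entry).contDiffAt.inv hA) ?_
  refine (contDiff_matrix_det fun k l => ?_).contDiffAt
  by_cases hk : k = j
  · subst hk
    simpa using contDiff_const
  · simpa [Matrix.updateRow_ne hk] using contDiff_matrix_entry k l

theorem det_coe_ne_zero (g : GL m ℝ) : (g : Matrix m m ℝ).det ≠ 0 :=
  ((Matrix.isUnit_iff_isUnit_det _).1 g.isUnit).ne_zero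

end Inverse

/-! ### Immersions from differentiable left inverses -/

section Immersion

variable {m : Type} [Fintype m] [DecidableEq m] {F : Type} [NormedAddCommGroup F]
  [NormedSpace ℝ F] {S : Subgroup (GL m ℝ)} {b : S → F} {f : Matrix m m ℝ → F}
  {g : F → Matrix m m ℝ}

/-- A map on a matrix group that extends smoothly, and from which the inclusion is recovered
by a map differentiable at the image of the identity, is an immersion at the identity. -/
theorem isImmersionAtOne_of_leftInverse (hf : ∀ p : S, ContDiffAt ℝ ∞ f (incl S p))
    (hb : ∀ p, b p = f (incl S p)) (hg : DifferentiableAt ℝ g (b 1))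
    (hgb : ∀ p, g (b p) = incl S p) : IsImmersionAtOne S b := by
  refine ⟨fun p => ⟨f, hf p, Eventually.of_forall hb⟩, ?_⟩
  have key : ∀ (γ : ℝ → S), IsCurve S γ → ∀ A : lieAlg S,
      HasDerivAt (fun t => incl S (γ t)) (A : Matrix m m ℝ) 0 →
      HasDerivAt (fun t => b (γ t)) (fderiv ℝ f (incl S 1) A) 0 := by
    intro γ hγ A hA
    have h1 : HasFDerivAt f (fderiv ℝ f (incl S 1)) (incl S (γ 0)) := by
      rw [hγ.map_zero]
      exact ((hf 1).differentiableAt (by simp)).hasFDerivAt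
    simp only [hb]
    exact h1.comp_hasDerivAt (0 : ℝ) hA
  refine ⟨(fderiv ℝ f (incl S 1)).toLinearMap ∘ₗ (lieAlg S).subtype, ?_, key⟩
  -- Realize `A` as the velocity of a curve `γ` and differentiate `g ∘ b ∘ γ = incl ∘ γ`; uniqueness
  -- of derivatives gives `dg (df A) = A`.
  have hinv : ∀ A : lieAlg S,
      fderiv ℝ g (b 1) (fderiv ℝ f (incl S 1) A) = (A : Matrix m m ℝ) := by
    intro A
    obtain ⟨γ, hγ, hA⟩ := A.2
    have h1 : HasFDerivAt g (fderiv ℝ g (b 1)) (b (γ 0)) := by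
      rw [hγ.map_zero]
      exact hg.hasFDerivAt
    have h2 := h1.comp_hasDerivAt (0 : ℝ) (key γ hγ A hA)
    have h3 : (g ∘ fun t => b (γ t)) = fun t => incl S (γ t) := funext fun t => hgb _
    rw [h3] at h2
    exact h2.unique hA
  intro A B hAB
  ext1
  rw [← hinv A, ← hinv B]
  exact congrArg _ hAB

/-- A map as in `isImmersionAtOne_of_leftInverse` is smooth, with injective differential at the
identity, for every manifold structure for which the inclusion is a smooth immersion. -/
theorem contMDiff_and_injective_mfderiv_of_leftInverse
    (hf : ∀ p : S, ContDiffAt ℝ ∞ f (incl S p))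
    (hb : ∀ p, b p = f (incl S p)) (hg : DifferentiableAt ℝ g (b 1))
    (hgb : ∀ p, g (b p) = incl S p) (d : ℕ) [ChartedSpace (EuclideanSpace ℝ (Fin d)) S]
    (hsmooth : ContMDiff (𝓡 d) 𝓘(ℝ, Matrix m m ℝ) ∞ (incl S))
    (himm : Function.Injective (mfderiv (𝓡 d) 𝓘(ℝ, Matrix m m ℝ) (incl S) 1)) :
    ContMDiff (𝓡 d) 𝓘(ℝ, F) ∞ b ∧ Function.Injective (mfderiv (𝓡 d) 𝓘(ℝ, F) b 1) := by
  have hbs : ContMDiff (𝓡 d) 𝓘(ℝ, F) ∞ b := by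
    have hbf : b = f ∘ incl S := funext hb
    rw [hbf]
    exact fun p => ContMDiffAt.comp p (hf p).contMDiffAt (hsmooth p)
  refine ⟨hbs, ?_⟩
  have h1 : g ∘ b = incl S := funext hgb
  have h2 := mfderiv_comp (1 : S) (I := 𝓡 d) (I' := 𝓘(ℝ, F)) (I'' := 𝓘(ℝ, Matrix m m ℝ))
    hg.mdifferentiableAt ((hbs 1).mdifferentiableAt (by simp))
  rw [h1] at h2
  intro v w hvw
  apply himm
  rw [h2]
  exact congrArg (mfderiv 𝓘(ℝ, F) 𝓘(ℝ, Matrix m m ℝ) g (b 1)) hvw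

end Immersion

/-! ### The Lie algebra of `N`, its dual, and the map `β` -/

section Blocks

variable {n : ℕ}

/-- Every strictly upper block triangular matrix lies in the Lie algebra of `N`. -/
theorem fromBlocks_mem_lieAlg_groupN (x : Matrix (Fin n) (Fin n) ℝ) :
    Matrix.fromBlocks 0 x 0 0 ∈ lieAlg (groupN n) := by
  let X : Matrix (Fin n ⊕ Fin n) (Fin n ⊕ Fin n) ℝ := Matrix.fromBlocks 0 x 0 0
  -- Nilpotency makes `1 - t X` the inverse of `1 + t X`, so the line `1 + t X` is a curve in `N`.
  have hX : X * X = 0 := by simp [X, Matrix.fromBlocks_multiply]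
  let γ : ℝ → groupN n := fun t =>
    ⟨⟨1 + t • X, 1 - t • X, by simp [mul_sub, add_mul, hX], by simp [mul_add, sub_mul, hX]⟩,
      t • x, by
        simp [X, Matrix.fromBlocks_smul, ← Matrix.fromBlocks_one, Matrix.fromBlocks_add]⟩
  have hγ : (fun t => incl (groupN n) (γ t)) = fun t => 1 + t • X := rfl
  refine ⟨γ, ⟨?_, ?_⟩, ?_⟩
  · rw [hγ]
    exact contDiff_const.add (contDiff_id.smul contDiff_const)
  · ext1; ext1; simp [γ]
  · rw [hγ]
    simpa using ((hasDerivAt_id (0 : ℝ)).smul_const X).const_add 1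

/-- The Lie algebra of `N` consists of strictly upper block triangular matrices. -/
theorem exists_eq_fromBlocks_of_mem_lieAlg_groupN
    {X : Matrix (Fin n ⊕ Fin n) (Fin n ⊕ Fin n) ℝ} (hX : X ∈ lieAlg (groupN n)) :
    X = Matrix.fromBlocks 0 X.toBlocks₁₂ 0 0 := by
  obtain ⟨γ, -, hX⟩ := hX
  have hder : ∀ i j, HasDerivAt (fun t => incl (groupN n) (γ t) i j) (X i j) 0 :=
    fun i j => hasDerivAt_pi.1 (hasDerivAt_pi.1 hX i) j
  -- Outside the upper right block the entries are constant along a curve in `N`, so their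
  -- velocities vanish.
  have hconst : ∀ i j (c : ℝ), (∀ t, incl (groupN n) (γ t) i j = c) → X i j = 0 := by
    intro i j c h
    have h1 := hder i j
    simp only [h] at h1
    exact h1.unique (hasDerivAt_const _ _)
  have hform : ∀ t, ∃ x, incl (groupN n) (γ t) = Matrix.fromBlocks 1 x 0 1 := fun t => (γ t).2
  ext (i | i) (j | j)
  · refine hconst _ _ ((1 : Matrix (Fin n) (Fin n) ℝ) i j) fun t => ?_
    obtain ⟨x, hx⟩ := hform t
    simp [hx]
  · rfl
  · refine hconst _ _ 0 fun t => ?_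
    obtain ⟨x, hx⟩ := hform t
    simp [hx]
  · refine hconst _ _ ((1 : Matrix (Fin n) (Fin n) ℝ) i j) fun t => ?_
    obtain ⟨x, hx⟩ := hform t
    simp [hx]

theorem functional_apply (w : Matrix (Fin n) (Fin n) ℝ) (X : lieAlg (groupN n)) :
    functional w X =
      (wᵀ * (X : Matrix (Fin n ⊕ Fin n) (Fin n ⊕ Fin n) ℝ).toBlocks₁₂).trace := by
  change ((Matrix.fromBlocks 0 w 0 0)ᵀ *
    (X : Matrix (Fin n ⊕ Fin n) (Fin n ⊕ Fin n) ℝ)).trace = _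
  conv_lhs => rw [exists_eq_fromBlocks_of_mem_lieAlg_groupN X.2]
  simp [Matrix.fromBlocks_transpose, Matrix.fromBlocks_multiply, Matrix.trace]

/-- The matrix `w`, recovered from the functional given by `wᵀ`. -/
def matrixOfFunctional (μ : StrongDual ℝ (lieAlg (groupN n))) : Matrix (Fin n) (Fin n) ℝ :=
  -- The indices are swapped because `Tr(w E_{ji}) = w_{ij}`.
  Matrix.of fun i j => μ ⟨_, fromBlocks_mem_lieAlg_groupN (Matrix.single j i 1)⟩

theorem matrixOfFunctional_functional (w : Matrix (Fin n) (Fin n) ℝ) :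
    matrixOfFunctional (functional wᵀ) = w := by
  ext i j
  simp [matrixOfFunctional, functional_apply, Matrix.trace_mul_single]

theorem contDiff_matrixOfFunctional : ContDiff ℝ ∞ (matrixOfFunctional (n := n)) :=
  contDiff_matrix_iff.2 fun i j => by
    exact contDiff_id.clm_apply contDiff_const

/-- The functional given by the transpose of the upper left block of a matrix. -/
noncomputable def blockFunctional (n : ℕ) (M : Matrix (Fin n ⊕ Fin n) (Fin n ⊕ Fin n) ℝ) :
    StrongDual ℝ (lieAlg (groupN n)) :=
  functional M.toBlocks₁₁ᵀ

theorem contDiff_blockFunctional : ContDiff ℝ ∞ (blockFunctional n) := by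
  -- Since `𝔫` is finite-dimensional, smoothness into its dual can be tested on each vector `X`,
  -- where the value is linear in the entries of the matrix.
  refine contDiff_clm_apply_iff.2 fun X => ?_
  simp only [blockFunctional, functional_apply, Matrix.transpose_transpose, Matrix.trace,
    Matrix.diag_apply, Matrix.mul_apply]
  exact ContDiff.sum fun i _ => ContDiff.sum fun k _ =>
    (contDiff_matrix_entry (Sum.inl i) (Sum.inl k)).mul contDiff_const

theorem incl_toH (K : Subgroup (GL (Fin n) ℝ)) (h : K) :
    incl (groupH K) (toH K h) =
      Matrix.fromBlocks ((h : GL (Fin n) ℝ) : Matrix (Fin n) (Fin n) ℝ) 0 0 1 := rfl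

theorem exists_toH_eq (K : Subgroup (GL (Fin n) ℝ)) (p : groupH K) : ∃ h : K, toH K h = p := by
  obtain ⟨_, h, hh, rfl⟩ := p
  exact ⟨⟨h, hh⟩, rfl⟩

theorem beta_toH (K : Subgroup (GL (Fin n) ℝ)) (h : K) :
    beta K (functional 1) (toH K h) =
      functional (((h : GL (Fin n) ℝ)⁻¹ : GL (Fin n) ℝ) : Matrix (Fin n) (Fin n) ℝ)ᵀ := by
  ext X
  obtain ⟨X, hX⟩ := X
  -- Conjugating by the inverse puts `h⁻¹` on the left and `h` on the right; the latter only meets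
  -- the left block column, which vanishes on `𝔫`.
  have hcoe : ((Ad (groupN n)
      ⟨((⟨toH K h, groupH_le_groupG K (toH K h).2⟩⁻¹ : groupG K) : GL (Fin n ⊕ Fin n) ℝ),
        groupG_le_normalizer K (⟨toH K h, groupH_le_groupG K (toH K h).2⟩⁻¹ : groupG K).2⟩
        ⟨X, hX⟩ : lieAlg (groupN n)) : Matrix (Fin n ⊕ Fin n) (Fin n ⊕ Fin n) ℝ) =
      Matrix.fromBlocks (((h : GL (Fin n) ℝ)⁻¹ : GL (Fin n) ℝ) : Matrix (Fin n) (Fin n) ℝ) 0 0 1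
        * X * Matrix.fromBlocks ((h : GL (Fin n) ℝ) : Matrix (Fin n) (Fin n) ℝ) 0 0 1 := rfl
  change functional 1 (Ad (groupN n) _ ⟨X, hX⟩) = _
  rw [functional_apply, functional_apply, hcoe]
  conv_lhs => rw [exists_eq_fromBlocks_of_mem_lieAlg_groupN hX]
  simp [Matrix.fromBlocks_multiply, -Matrix.coe_units_inv]

/-- The right-hand side makes sense on the whole matrix space and is smooth near `H`, which provides
the ambient extension of `β`. -/
theorem beta_eq_blockFunctional (K : Subgroup (GL (Fin n) ℝ)) (p : groupH K) :
    beta K (functional 1) p = blockFunctional n (incl (groupH K) p)⁻¹ := by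
  obtain ⟨h, rfl⟩ := exists_toH_eq K p
  have hinv : (incl (groupH K) (toH K h))⁻¹ = Matrix.fromBlocks
      (((h : GL (Fin n) ℝ)⁻¹ : GL (Fin n) ℝ) : Matrix (Fin n) (Fin n) ℝ) 0 0 1 := by
    apply Matrix.inv_eq_right_inv
    simp [incl_toH, Matrix.fromBlocks_multiply, -Matrix.coe_units_inv]
  rw [beta_toH, hinv]
  rfl

theorem matrixOfFunctional_beta_toH (K : Subgroup (GL (Fin n) ℝ)) (h : K) :
    matrixOfFunctional (beta K (functional 1) (toH K h)) =
      (((h : GL (Fin n) ℝ)⁻¹ : GL (Fin n) ℝ) : Matrix (Fin n) (Fin n) ℝ) := by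
  rw [beta_toH, matrixOfFunctional_functional]

/-- The inclusion of `H` is recovered from `β`. -/
theorem fromBlocks_matrixOfFunctional_beta (K : Subgroup (GL (Fin n) ℝ)) (p : groupH K) :
    Matrix.fromBlocks (matrixOfFunctional (beta K (functional 1) p))⁻¹ 0 0 1 =
      incl (groupH K) p := by
  obtain ⟨h, rfl⟩ := exists_toH_eq K p
  rw [matrixOfFunctional_beta_toH, incl_toH, ← Matrix.coe_units_inv, inv_inv]

/-- Smoothness of the left inverse `g`; the determinant condition is what inverting the recovered
matrix requires. -/
theorem contDiffAt_fromBlocks_matrixOfFunctional {μ : StrongDual ℝ (lieAlg (groupN n))}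
    (hμ : (matrixOfFunctional μ).det ≠ 0) :
    ContDiffAt ℝ ∞ (fun ν : StrongDual ℝ (lieAlg (groupN n)) =>
      (Matrix.fromBlocks (matrixOfFunctional ν)⁻¹ 0 0 1 :
        Matrix (Fin n ⊕ Fin n) (Fin n ⊕ Fin n) ℝ)) μ := by
  have h := ContDiffAt.comp μ (contDiffAt_matrix_inv hμ) contDiff_matrixOfFunctional.contDiffAt
  refine contDiffAt_matrix_iff.2 ?_
  rintro (i | i) (j | j)
  · exact contDiffAt_matrix_iff.1 h i j
  all_goals exact contDiffAt_const

end Blocks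

end MatrixLie

theorem mainTheorem6 (n : ℕ) (K : Subgroup (GL (Fin n) ℝ))
    (hKclosed : IsClosed (K : Set (GL (Fin n) ℝ)))
    (hKconn : IsConnected (K : Set (GL (Fin n) ℝ))) :
    ∃ μ : StrongDual ℝ (MatrixLie.lieAlg (MatrixLie.groupN n)),
      -- `μ` is the functional given by the identity matrix
      μ = MatrixLie.functional 1 ∧
      -- `β_μ(h)` is the functional given by the transpose of `h⁻¹`
      (∀ h : K, MatrixLie.beta K μ (MatrixLie.toH K h) =
        MatrixLie.functional
          (((h : GL (Fin n) ℝ)⁻¹ : GL (Fin n) ℝ) : Matrix (Fin n) (Fin n) ℝ)ᵀ) ∧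
      -- `β_μ` is a smooth map on the matrix group `H` and an immersion at its identity
      MatrixLie.IsImmersionAtOne (MatrixLie.groupH K) (MatrixLie.beta K μ) ∧
      -- the same for every structure of a smooth manifold on `H` (with the subspace topology)
      -- for which the inclusion into the space of matrices is an immersion
      (∀ (d : ℕ) [ChartedSpace (EuclideanSpace ℝ (Fin d)) (MatrixLie.groupH K)]
        [IsManifold (𝓡 d) ∞ (MatrixLie.groupH K)],
        ContMDiff (𝓡 d) 𝓘(ℝ, Matrix (Fin n ⊕ Fin n) (Fin n ⊕ Fin n) ℝ) ∞
          (MatrixLie.incl (MatrixLie.groupH K)) →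
        (∀ p : MatrixLie.groupH K, Function.Injective
          (mfderiv (𝓡 d) 𝓘(ℝ, Matrix (Fin n ⊕ Fin n) (Fin n ⊕ Fin n) ℝ)
            (MatrixLie.incl (MatrixLie.groupH K)) p)) →
        ContMDiff (𝓡 d) 𝓘(ℝ, StrongDual ℝ (MatrixLie.lieAlg (MatrixLie.groupN n))) ∞
          (MatrixLie.beta K μ) ∧
        Function.Injective
          (mfderiv (𝓡 d) 𝓘(ℝ, StrongDual ℝ (MatrixLie.lieAlg (MatrixLie.groupN n)))
            (MatrixLie.beta K μ) 1)) := by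
  have hf : ∀ p : MatrixLie.groupH K, ContDiffAt ℝ ∞
      (fun M : Matrix (Fin n ⊕ Fin n) (Fin n ⊕ Fin n) ℝ => MatrixLie.blockFunctional n M⁻¹)
      (MatrixLie.incl (MatrixLie.groupH K) p) := fun p =>
    ContDiffAt.comp (g := MatrixLie.blockFunctional n) _ MatrixLie.contDiff_blockFunctional.contDiffAt
      (MatrixLie.contDiffAt_matrix_inv (MatrixLie.det_coe_ne_zero _))
  -- At `β(1)` the recovered matrix is the inverse of an element of `K`, hence invertible.
  have hg := (MatrixLie.contDiffAt_fromBlocks_matrixOfFunctional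
    (μ := MatrixLie.beta K (MatrixLie.functional 1) 1) (by
      obtain ⟨h, hh⟩ := MatrixLie.exists_toH_eq K 1
      rw [← hh, MatrixLie.matrixOfFunctional_beta_toH]
      exact MatrixLie.det_coe_ne_zero _)).differentiableAt (by simp)
  refine ⟨MatrixLie.functional 1, rfl, MatrixLie.beta_toH K,
    MatrixLie.isImmersionAtOne_of_leftInverse hf (MatrixLie.beta_eq_blockFunctional K) hg
      (MatrixLie.fromBlocks_matrixOfFunctional_beta K), ?_⟩
  intro d _ _ hsmooth himm
  exact MatrixLie.contMDiff_and_injective_mfderiv_of_leftInverse hf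
    (MatrixLie.beta_eq_blockFunctional K) hg
    (MatrixLie.fromBlocks_matrixOfFunctional_beta K) d hsmooth (himm 1)
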